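/- Let $V=\bigoplus_{n\in\mathbb Z}V_n$ be a vertex operator algebra over $\mathbb C$, with vertex operators $Y(v,z)=\sum_{n\in\mathbb Z}v_nz^{-n-1}$, vacuum vector $\mathbf 1$ and conformal vector $\omega$, so that $L(0)=\omega_1$ acts on $V_n$ as multiplication by $n$. Assume that $V$ is of CFT type, that is, $V_n=0$ for $n<0$ and $V_0=\mathbb C\mathbf 1$, and that $V$ is $C_2$-cofinite, that is, $V/C_2(V)$ is finite dimensional, where $C_2(V)$ is the linear span of all $u_{-2}v$ with $u,v\in V$. A weak $V$-module is a complex vector space $M$ with a linear map $v\mapsto Y_M(v,z)=\sum_{n\in\mathbb Z}v_nz^{-n-1}$ from $V$ to $(\operatorname{End}M)[[z,z^{-1}]]$ such that $v_nw=0$ for all sufficiently large $n$ (for each $v\in V$, $w\in M$), $Y_M(\mathbf 1,z)=\mathrm{id}_M$, and the Jacobi identity $$z_0^{-1}\delta\Big(\frac{z_1-z_2}{z_0}\Big)Y_M(u,z_1)Y_M(v,z_2)-z_0^{-1}\delta\Big(\frac{z_2-z_1}{-z_0}\Big)Y_M(v,z_2)Y_M(u,z_1)=z_2^{-1}\delta\Big(\frac{z_1-z_0}{z_2}\Big)Y_M(Y(u,z_0)v,z_2)$$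 holds for all $u,v\in V$. A vector $w\in M$ is a lowest weight vector if $v_nw=0$ for every $k\in\mathbb Z$, every $v\in V_k$ and every $n\in\mathbb Z$ such that the weight $\operatorname{wt}(v_n)=k-n-1$ is negative. Then every nonzero weak $V$-module $M$ contains a nonzero lowest weight vector. -/

import Mathlib

/-- The coefficients of the Jacobi identity, for the vertex operators
`Y(u, z) = ∑ u_n z^(-n-1)` on `V` (given by `Y u n = u_n`) and
`Y_M(u, z) = ∑ u_n z^(-n-1)` on `M` (given by `YM u n = u_n`).
Comparing the coefficients of `z₀^(-l-1) z₁^(-m-1) z₂^(-n-1)` in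
`z₀⁻¹ δ((z₁-z₂)/z₀) Y_M(u,z₁) Y_M(v,z₂) - z₀⁻¹ δ((z₂-z₁)/(-z₀)) Y_M(v,z₂) Y_M(u,z₁)
  = z₂⁻¹ δ((z₁-z₀)/z₂) Y_M(Y(u,z₀)v,z₂)`,
where binomials are expanded in nonnegative powers of their second variable, gives, on `w`,
`∑ᵢ (-1)^i (l choose i) u_{l+m-i} v_{n+i} w - ∑ᵢ (-1)^(l+i) (l choose i) v_{l+n-i} u_{m+i} w
  = ∑ᵢ (m choose i) (u_{l+i} v)_{m+n-i} w`.
All the sums have only finitely many nonzero terms as soon as `Y` and `YM` are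
lower truncated, which is required wherever this is used. -/
def JacobiIdentity {V M : Type*} [AddCommGroup V] [Module ℂ V] [AddCommGroup M] [Module ℂ M]
    (Y : V →ₗ[ℂ] ℤ → Module.End ℂ V) (YM : V →ₗ[ℂ] ℤ → Module.End ℂ M) : Prop :=
  ∀ (u v : V) (w : M) (l m n : ℤ),
    (∑ᶠ i : ℕ, ((-1 : ℤ) ^ i * Ring.choose l i) • YM u (l + m - i) (YM v (n + i) w))
      - (∑ᶠ i : ℕ, ((l.negOnePow : ℤ) * (-1 : ℤ) ^ i * Ring.choose l i) •
          YM v (l + n - i) (YM u (m + i) w))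
      = ∑ᶠ i : ℕ, (Ring.choose m i) • YM (Y u (l + i) v) (m + n - i) w

/-- A vertex operator algebra structure on the complex vector space `V`. -/
structure VertexOperatorAlgebra (V : Type*) [AddCommGroup V] [Module ℂ V] where
  /-- The state-field correspondence: `Y v n` is the mode `v_n` in
  `Y(v, z) = ∑ v_n z^(-n-1)`. -/
  Y : V →ₗ[ℂ] ℤ → Module.End ℂ V
  /-- The vacuum vector `𝟏`. -/
  vac : V
  /-- The conformal (Virasoro) vector. -/
  omega : V
  /-- The central charge. -/
  c : ℂ
  /-- The homogeneous subspaces `V_n`. -/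
  gr : ℤ → Submodule ℂ V
  /-- `u_n v = 0` for `n` large. -/
  truncation : ∀ u v : V, ∃ N : ℤ, ∀ n : ℤ, N ≤ n → Y u n v = 0
  /-- `Y(𝟏, z) = id`. -/
  vacuum : ∀ n : ℤ, Y vac n = if n = -1 then LinearMap.id else 0
  /-- `Y(v, z)𝟏` has no singular terms. -/
  creation : ∀ (v : V) (n : ℤ), 0 ≤ n → Y v n vac = 0
  /-- The constant term of `Y(v, z)𝟏` is `v`. -/
  creation_const : ∀ v : V, Y v (-1) vac = v
  jacobi : JacobiIdentity Y Y
  /-- The operators `L(n) = ω_{n+1}` satisfy the Virasoro relations. -/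
  virasoro : ∀ m n : ℤ,
    Y omega (m + 1) ∘ₗ Y omega (n + 1) - Y omega (n + 1) ∘ₗ Y omega (m + 1) =
      ((m : ℂ) - (n : ℂ)) • Y omega (m + n + 1) +
        (if m + n = 0 then (((m : ℂ) ^ 3 - (m : ℂ)) / 12 * c) • LinearMap.id else 0)
  /-- `Y(L(-1)v, z) = d/dz Y(v, z)`. -/
  derivation : ∀ (v : V) (n : ℤ), Y (Y omega 0 v) n = (-(n : ℂ)) • Y v (n - 1)
  /-- `V` is the direct sum of the `V_n`. -/
  isInternal : DirectSum.IsInternal gr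
  /-- `L(0)` acts on `V_n` as multiplication by `n`. -/
  weight : ∀ (n : ℤ) (v : V), v ∈ gr n → Y omega 1 v = (n : ℂ) • v
  finite_gr : ∀ n : ℤ, FiniteDimensional ℂ (gr n)
  /-- `V_n = 0` for `n` sufficiently negative. -/
  gr_bounded : ∃ N : ℤ, ∀ n : ℤ, n < N → gr n = ⊥

namespace VertexOperatorAlgebra

variable {V : Type*} [AddCommGroup V] [Module ℂ V]

/-- `V` is of CFT type: `V = ⨁_{n ≥ 0} V_n` and `V_0 = ℂ𝟏`. -/
def IsCFTType (A : VertexOperatorAlgebra V) : Prop :=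
  (∀ n : ℤ, n < 0 → A.gr n = ⊥) ∧ A.gr 0 = Submodule.span ℂ {A.vac}

/-- `C_n(V)`, the linear span of all `u_{-n} v` with `u, v ∈ V`. -/
def C (A : VertexOperatorAlgebra V) (n : ℕ) : Submodule ℂ V :=
  Submodule.span ℂ {x | ∃ u v : V, x = A.Y u (-(n : ℤ)) v}

/-- `C_n`-cofiniteness (for `n ≥ 2`): `V / C_n(V)` is finite dimensional. -/
def IsCofinite (A : VertexOperatorAlgebra V) (n : ℕ) : Prop :=
  FiniteDimensional ℂ (V ⧸ A.C n)

/-- A weak module structure on the complex vector space `M` for the vertex operator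
algebra `A` on `V`. -/
structure WeakModule (A : VertexOperatorAlgebra V)
    (M : Type*) [AddCommGroup M] [Module ℂ M] where
  /-- `Y v n` is the mode `v_n` in `Y_M(v, z) = ∑ v_n z^(-n-1)`. -/
  Y : V →ₗ[ℂ] ℤ → Module.End ℂ M
  /-- `v_n w = 0` for `n` large. -/
  truncation : ∀ (v : V) (w : M), ∃ N : ℤ, ∀ n : ℤ, N ≤ n → Y v n w = 0
  /-- `Y_M(𝟏, z) = id`. -/
  vacuum : ∀ n : ℤ, Y A.vac n = if n = -1 then LinearMap.id else 0
  jacobi : JacobiIdentity A.Y Y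

/-- `w` is a lowest weight vector: `v_n w = 0` for each homogeneous `v`, say `v ∈ V_k`, and each
`n` such that the weight `wt(v_n) = k - n - 1` of the operator `v_n` is negative. -/
def WeakModule.IsLowestWeightVector {A : VertexOperatorAlgebra V}
    {M : Type*} [AddCommGroup M] [Module ℂ M] (W : A.WeakModule M) (w : M) : Prop :=
  ∀ (k : ℤ) (v : V), v ∈ A.gr k → ∀ n : ℤ, k - n - 1 < 0 → W.Y v n w = 0

end VertexOperatorAlgebra

/-! Say that `w` has slope at most `q / D` if `v_n w = 0` whenever `v ∈ V_k` and `-wt(v_n) > (q / D)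
k`; slope `0` means lowest weight. By `C_2`-cofiniteness, `V` is generated modulo `C_2(V)` in
weights at most some `K`, and a slope bound checked there holds everywhere, so every vector has some
finite slope bound. Take `D = K!`. At slope `q / D > 0`, call `v_n` extremal if `-wt(v_n) = (q / D)
k`. Extremal modes of weight `k > K` kill `w`, and on `w` an extremal mode of `u_{-1} v` is the
product of extremal modes of `u` and `v`. Choose an extremal `v_n` with `v_n w ≠ 0` and `v` of
maximal weight: every extremal mode of positive weight then kills `v_n w`, which therefore has slope
at most `(q - 1) / D`. Descend to `0`. -/

namespace JacobiIdentity

variable {V M : Type*} [AddCommGroup V] [Module ℂ V] [AddCommGroup M] [Module ℂ M]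
  {Y : V →ₗ[ℂ] ℤ → Module.End ℂ V} {YM : V →ₗ[ℂ] ℤ → Module.End ℂ M}

/-- Borcherds' commutator formula. -/
theorem commutator (h : JacobiIdentity Y YM) (u v : V) (w : M) (m n : ℤ) :
    YM u m (YM v n w) - YM v n (YM u m w) =
      ∑ᶠ i : ℕ, (Ring.choose m i) • YM (Y u i v) (m + n - i) w := by
  have key := h u v w 0 m n
  have hz : ∀ i : ℕ, i ≠ 0 → Ring.choose (0 : ℤ) i = 0 := fun i hi =>
    Ring.choose_zero_pos ℤ (Nat.pos_of_ne_zero hi)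
  rw [finsum_eq_single _ 0 (fun i hi => by simp [hz i hi]),
    finsum_eq_single _ 0 (fun i hi => by simp [hz i hi])] at key
  simpa using key

/-- Borcherds' iterate formula. -/
theorem iterate (h : JacobiIdentity Y YM) (u v : V) (w : M) (l n : ℤ) :
    YM (Y u l v) n w =
      (∑ᶠ i : ℕ, ((-1 : ℤ) ^ i * Ring.choose l i) • YM u (l - i) (YM v (n + i) w)) -
      ∑ᶠ i : ℕ, ((l.negOnePow : ℤ) * (-1 : ℤ) ^ i * Ring.choose l i) •
          YM v (l + n - i) (YM u i w) := by
  have key := h u v w l 0 n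
  have hz : ∀ i : ℕ, i ≠ 0 → Ring.choose (0 : ℤ) i = 0 := fun i hi =>
    Ring.choose_zero_pos ℤ (Nat.pos_of_ne_zero hi)
  rw [finsum_eq_single (fun i : ℕ => (Ring.choose (0 : ℤ) i) • YM (Y u (l + i) v) (0 + n - i) w) 0
    (fun i hi => by simp [hz i hi])] at key
  simpa using key.symm

end JacobiIdentity

/-! ### Grading and generators modulo `C_2(V)` -/

namespace VertexOperatorAlgebra

variable {V : Type*} [AddCommGroup V] [Module ℂ V] (A : VertexOperatorAlgebra V)

theorem mem_gr_of_eigenvector {n : ℤ} {x : V} (hx : A.Y A.omega 1 x = (n : ℂ) • x) :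
    x ∈ A.gr n := by
  classical
  let _ := A.isInternal.chooseDecomposition
  have hsum := DirectSum.sum_support_decompose A.gr x
  have hL : ∀ i, (DirectSum.decompose A.gr (A.Y A.omega 1 x) i : V) =
      (i : ℂ) • (DirectSum.decompose A.gr x i : V) := by
    intro i
    conv_lhs => rw [← hsum]
    rw [map_sum, DirectSum.decompose_sum, DFinsupp.finsetSum_apply, AddSubmonoidClass.coe_finsetSum,
      Finset.sum_eq_single i]
    · rw [A.weight i _ (SetLike.coe_mem _), DirectSum.decompose_smul, DirectSum.smul_apply]
      simp
    · intro j _ hj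
      rw [A.weight j _ (SetLike.coe_mem _), DirectSum.decompose_smul, DirectSum.smul_apply]
      simp [DirectSum.of_eq_of_ne _ _ _ hj.symm]
    · intro hi
      rw [DFinsupp.notMem_support_iff] at hi
      simp [hi]
  rw [← hsum]
  refine Submodule.sum_mem _ fun i _ => ?_
  by_cases hi : i = n
  · subst hi; exact SetLike.coe_mem _
  · have h := hL i
    rw [hx, DirectSum.decompose_smul, DirectSum.smul_apply, Submodule.coe_smul, ← sub_eq_zero,
      ← sub_smul, smul_eq_zero, sub_eq_zero] at h
    rcases h with h | h
    · exact absurd (by exact_mod_cast h.symm) hi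
    · rw [h]; exact zero_mem _

/-- The mode `u_n` of `u ∈ V_j` is homogeneous of weight `j - n - 1`. -/
theorem mode_mem_gr {j k : ℤ} {u v : V} (hu : u ∈ A.gr j) (hv : v ∈ A.gr k) (n : ℤ) :
    A.Y u n v ∈ A.gr (j + k - n - 1) := by
  apply A.mem_gr_of_eigenvector
  have key := A.jacobi.commutator A.omega u v 1 n
  have hz : ∀ i : ℕ, 2 ≤ i → Ring.choose (1 : ℤ) i = 0 := fun i hi => by
    have := Ring.choose_natCast (R := ℤ) 1 i
    rw [Nat.choose_eq_zero_of_lt (by omega)] at this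
    simpa using this
  rw [finsum_eq_sum_of_support_subset (s := Finset.range 2) _ (by
    intro i hi
    by_contra hc
    simp only [Finset.coe_range, Set.mem_Iio, not_lt] at hc
    simp [hz i hc] at hi)] at key
  simp only [Finset.sum_range_succ, Finset.range_zero, Finset.sum_empty, Nat.cast_zero,
    Nat.cast_one, Ring.choose_zero_right, Ring.choose_one_right, one_smul, zero_add, sub_zero,
    A.derivation, A.weight j u hu, A.weight k v hv, map_smul, Pi.smul_apply,
    LinearMap.smul_apply, add_sub_cancel_left] at key
  rw [sub_eq_iff_eq_add] at key
  rw [key, ← add_smul, ← add_smul]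
  congr 1
  push_cast
  ring

/-- The part of `C_2(V)` of weight `k` is spanned by the `u_{-2} v` with `u`, `v` homogeneous. -/
theorem decompose_mem_of_mem_C_two [DirectSum.Decomposition A.gr] {x : V} (hx : x ∈ A.C 2)
    (k : ℤ) : (DirectSum.decompose A.gr x k : V) ∈ Submodule.span ℂ
      {y | ∃ i j : ℤ, ∃ u ∈ A.gr i, ∃ v ∈ A.gr j, i + j + 1 = k ∧ y = A.Y u (-2) v} := by
  classical
  refine Submodule.span_induction ?_ ?_ ?_ ?_ hx
  · rintro _ ⟨u, v, rfl⟩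
    rw [← DirectSum.sum_support_decompose A.gr u, ← DirectSum.sum_support_decompose A.gr v]
    simp only [map_sum, LinearMap.sum_apply, Finset.sum_apply]
    rw [DirectSum.decompose_sum, DFinsupp.finsetSum_apply, AddSubmonoidClass.coe_finsetSum]
    refine Submodule.sum_mem _ fun i _ => ?_
    rw [DirectSum.decompose_sum, DFinsupp.finsetSum_apply, AddSubmonoidClass.coe_finsetSum]
    refine Submodule.sum_mem _ fun j _ => ?_
    have hm := A.mode_mem_gr (SetLike.coe_mem (DirectSum.decompose A.gr u j))
      (SetLike.coe_mem (DirectSum.decompose A.gr v i)) (-((2 : ℕ) : ℤ))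
    by_cases h : j + i + 1 = k
    · have e : j + i - -((2 : ℕ) : ℤ) - 1 = k := by push_cast; omega
      rw [e] at hm
      rw [DirectSum.decompose_of_mem_same _ hm]
      exact Submodule.subset_span ⟨j, i, _, SetLike.coe_mem _, _, SetLike.coe_mem _, h, rfl⟩
    · rw [DirectSum.decompose_of_mem_ne _ hm (by push_cast; omega)]
      exact zero_mem _
  · simp
  · intro x y _ _ hx hy
    rw [DirectSum.decompose_add, DirectSum.add_apply, Submodule.coe_add]
    exact add_mem hx hy
  · intro a x _ hx
    rw [DirectSum.decompose_smul, DirectSum.smul_apply, Submodule.coe_smul]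
    exact Submodule.smul_mem _ _ hx

/-- Finitely many representatives span `V / C_2(V)`, and `K` bounds the degrees of all their
components. -/
theorem exists_gr_le_span_of_isCofinite (h : A.IsCofinite 2) :
    ∃ K : ℕ, ∀ k : ℤ, K < k → A.gr k ≤ Submodule.span ℂ
      {y | ∃ i j : ℤ, ∃ u ∈ A.gr i, ∃ v ∈ A.gr j, i + j + 1 = k ∧ y = A.Y u (-2) v} := by
  classical
  let _ := A.isInternal.chooseDecomposition
  obtain ⟨s, hs⟩ := (h : Module.Finite ℂ (V ⧸ A.C 2)).fg_top
  choose f hf using (A.C 2).mkQ_surjective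
  obtain ⟨K, hK⟩ := (s.biUnion fun q => (DirectSum.decompose A.gr (f q)).support).exists_le
  refine ⟨K.toNat, fun k hk v hv => ?_⟩
  have hv' : (A.C 2).mkQ v ∈ Submodule.span ℂ (s : Set (V ⧸ A.C 2)) := by rw [hs]; trivial
  have hs' : (s : Set (V ⧸ A.C 2)) = (A.C 2).mkQ '' (f '' s) := by
    rw [Set.image_image]; simp [hf]
  rw [hs', Submodule.span_image] at hv'
  obtain ⟨x, hx, hxv⟩ := hv'
  have hxk : (DirectSum.decompose A.gr x k : V) = 0 := by
    refine Submodule.span_induction ?_ ?_ ?_ ?_ hx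
    · rintro _ ⟨q, hq, rfl⟩
      by_contra hne
      have := hK k (Finset.mem_biUnion.2 ⟨q, hq, by
        rw [DFinsupp.mem_support_iff]
        intro h0
        exact hne (by rw [h0]; rfl)⟩)
      omega
    · simp
    · intro x y _ _ hx hy
      rw [DirectSum.decompose_add, DirectSum.add_apply, Submodule.coe_add, hx, hy, add_zero]
    · intro a x _ hx
      rw [DirectSum.decompose_smul, DirectSum.smul_apply, Submodule.coe_smul, hx, smul_zero]
  have hmem : v - x ∈ A.C 2 := by
    rw [← Submodule.Quotient.mk_eq_zero, Submodule.Quotient.mk_sub, sub_eq_zero]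
    exact hxv.symm
  have := A.decompose_mem_of_mem_C_two hmem k
  rwa [DirectSum.decompose_sub, DirectSum.sub_apply, AddSubgroupClass.coe_sub, hxk, sub_zero,
    DirectSum.decompose_of_mem_same _ hv] at this

/-! ### Slope bounds and extremal modes -/

namespace WeakModule

variable {A} {M : Type*} [AddCommGroup M] [Module ℂ M] (W : A.WeakModule M)

/-- The modes `v_n` with `v ∈ V_k`, `k < N`, whose weight `k - n - 1` is smaller than `-(q / D) k`,
annihilate `w`. -/
def HasSlopeLE (D q N : ℤ) (w : M) : Prop :=
  ∀ k < N, ∀ v ∈ A.gr k, ∀ n : ℤ, q * k < (n - k + 1) * D → W.Y v n w = 0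

variable {W} {D q N : ℤ} {w : M}

theorem HasSlopeLE.mono (h : W.HasSlopeLE D q N w) {N' : ℤ} (hN : N' ≤ N) :
    W.HasSlopeLE D q N' w :=
  fun k hk => h k (hk.trans_le hN)

/-- The commutator involves only modes of `u_i v` with `i ≥ 0`. These elements have weight at most
`j + k - 1`, and the modes have the same weight as `u_m v_n`, hence lie beyond the bound. -/
theorem HasSlopeLE.commute (h : W.HasSlopeLE D q N w) (hq : 0 ≤ q) {j k : ℤ} {u v : V}
    (hu : u ∈ A.gr j) (hv : v ∈ A.gr k) (hN : j + k ≤ N) {m n : ℤ}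
    (hmn : q * (j + k - 1) < (m + n - j - k + 2) * D) :
    W.Y u m (W.Y v n w) = W.Y v n (W.Y u m w) := by
  rw [← sub_eq_zero, W.jacobi.commutator]
  refine finsum_eq_zero_of_forall_eq_zero fun i => ?_
  rw [h (j + k - i - 1) (by omega) _ (A.mode_mem_gr hu hv i), smul_zero]
  have : m + n - i - (j + k - i - 1) + 1 = m + n - j - k + 2 := by ring
  rw [this]
  refine lt_of_le_of_lt ?_ hmn
  exact mul_le_mul_of_nonneg_left (by omega) hq

theorem HasSlopeLE.apply_apply_eq_zero (h : W.HasSlopeLE D q N w) (hq : 0 ≤ q) {j k : ℤ} {u v : V}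
    (hu : u ∈ A.gr j) (hv : v ∈ A.gr k) (hj : j < N) (hk : k < N) (hN : j + k ≤ N) {m n : ℤ}
    (hmn : q * (j + k - 1) < (m + n - j - k + 2) * D)
    (hne : q * j < (m - j + 1) * D ∨ q * k < (n - k + 1) * D) :
    W.Y u m (W.Y v n w) = 0 := by
  rcases hne with h1 | h1
  · rw [h.commute hq hu hv hN hmn, h j hj u hu m h1, map_zero]
  · rw [h k hk v hv n h1, map_zero]

/-- Each product in the iterate formula has total depth `n - j - k`, above the sum of the bounds for
`u` and `v`, so one factor exceeds its own bound. -/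
theorem HasSlopeLE.apply_neg_two_eq_zero (h : W.HasSlopeLE D q N w) (hq : 0 ≤ q) {j k : ℤ}
    {u v : V} (hu : u ∈ A.gr j) (hv : v ∈ A.gr k) (hj : j < N) (hk : k < N) (hN : j + k ≤ N)
    {n : ℤ} (hn : q * (j + k) < (n - j - k) * D) :
    W.Y (A.Y u (-2) v) n w = 0 := by
  have hle : q * (j + k - 1) ≤ q * (j + k) := mul_le_mul_of_nonneg_left (by omega) hq
  rw [W.jacobi.iterate, finsum_eq_zero_of_forall_eq_zero, finsum_eq_zero_of_forall_eq_zero,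
    sub_zero]
  · intro i
    rw [h.apply_apply_eq_zero hq hv hu hk hj (by omega), smul_zero]
    · have e1 : -2 + n - i + i - k - j + 2 = n - j - k := by ring
      rw [e1, add_comm k j]; linarith
    · by_contra! hc
      nlinarith [hc.1, hc.2]
  · intro i
    rw [h.apply_apply_eq_zero hq hu hv hj hk (by omega), smul_zero]
    · have e1 : -2 - i + (n + i) - j - k + 2 = n - j - k := by ring
      rw [e1]; linarith
    · by_contra! hc
      nlinarith [hc.1, hc.2]

/-- The modes of extremal slope of `u_{-1} v` are products of those of `u` and of `v`. -/
theorem HasSlopeLE.apply_neg_one (h : W.HasSlopeLE D q N w) (hq : 0 < q) (hD : 0 < D) {j k : ℤ}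
    {u v : V} (hu : u ∈ A.gr j) (hv : v ∈ A.gr k) (hj : j < N) (hk : k < N) (hN : j + k ≤ N)
    (hj0 : 0 < j) {m n : ℤ} (hm : (m - j + 1) * D = q * j) (hn : (n - k + 1) * D = q * k) :
    W.Y (A.Y u (-1) v) (m + n + 1) w = W.Y u m (W.Y v n w) := by
  have hsum : (m + n - j - k + 2) * D = q * (j + k) := by linarith
  have hlt : q * (j + k - 1) < q * (j + k) := mul_lt_mul_of_pos_left (by omega) hq
  -- The second sum of the iterate formula runs over `u_i` with `i ≥ 0`; its term `i = m` is the
  -- only survivor.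
  have hm0 : 0 ≤ m := by
    have : 0 < (m - j + 1) * D := hm ▸ mul_pos hq hj0
    have := pos_of_mul_pos_left this hD.le
    omega
  lift m to ℕ using hm0
  have hcoef : ∀ i : ℕ, (-1 : ℤ) ^ i * Ring.choose (-1 : ℤ) i = 1 := by
    intro i
    rw [Ring.choose_neg, add_sub_cancel_left, Ring.choose_natCast]
    simp [Units.smul_def, Int.coe_negOnePow_natCast, ← mul_pow]
  rw [W.jacobi.iterate, finsum_eq_zero_of_forall_eq_zero, finsum_eq_single _ m]
  · rw [mul_assoc, hcoef, h.commute hq.le hu hv hN (by rw [hsum]; exact hlt)]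
    have e : -1 + ((m : ℤ) + n + 1) - m = n := by ring
    rw [e]
    simp
  · intro i hi
    rw [h.apply_apply_eq_zero hq.le hv hu hk hj (by omega), smul_zero]
    · have e1 : -1 + ((m : ℤ) + n + 1) - i + i - k - j + 2 = m + n - j - k + 2 := by ring
      rw [e1, hsum, add_comm k j]; exact hlt
    · rcases lt_or_gt_of_ne hi with hi | hi
      · left
        rw [← hn]
        exact mul_lt_mul_of_pos_right (by omega) hD
      · right
        rw [← hm]
        exact mul_lt_mul_of_pos_right (by omega) hD
  · intro i
    rw [h.apply_apply_eq_zero hq.le hu hv hj hk (by omega), smul_zero]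
    · have e1 : -1 - (i : ℤ) + ((m : ℤ) + n + 1 + i) - j - k + 2 = m + n - j - k + 2 := by ring
      rw [e1, hsum]; exact hlt
    · right
      rw [← hn]
      exact mul_lt_mul_of_pos_right (by omega) hD

theorem HasSlopeLE.apply (h : ∀ N, W.HasSlopeLE D q N w) (hq : 0 < q) {k : ℤ} {v : V}
    (hv : v ∈ A.gr k) {n : ℤ} (hn : (n - k + 1) * D = q * k) (N : ℤ) :
    W.HasSlopeLE D q N (W.Y v n w) := by
  intro j _ u hu m hm
  have hlt : q * (j + k - 1) < q * (j + k) := mul_lt_mul_of_pos_left (by omega) hq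
  exact (h (max (max (j + 1) (k + 1)) (j + k))).apply_apply_eq_zero hq.le hu hv (by omega)
    (by omega) (by omega) (by linarith) (Or.inl hm)

/-- A slope bound only has to be checked on generators of `V` modulo `C_2(V)`. -/
theorem HasSlopeLE.of_generators (hneg : ∀ n : ℤ, n < 0 → A.gr n = ⊥) {K : ℕ}
    (hK : ∀ k : ℤ, K < k → A.gr k ≤ Submodule.span ℂ
      {y | ∃ i j : ℤ, ∃ u ∈ A.gr i, ∃ v ∈ A.gr j, i + j + 1 = k ∧ y = A.Y u (-2) v})
    (hq : 0 ≤ q) (h : W.HasSlopeLE D q (K + 1) w) (N : ℤ) : W.HasSlopeLE D q N w := by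
  suffices H : ∀ t : ℕ, W.HasSlopeLE D q (K + 1 + t) w from
    (H (N - (K + 1)).toNat).mono (by omega)
  intro t
  induction t with
  | zero => simpa using h
  | succ t ih =>
    intro k hk v hv n hn
    rcases lt_or_ge k (K + 1 + t) with hlt | hge
    · exact ih k hlt v hv n hn
    refine Submodule.span_induction (p := fun x _ => W.Y x n w = 0) ?_ ?_ ?_ ?_
      (hK k (by omega) hv)
    · rintro _ ⟨i, j, u, hu, v, hv, hij, rfl⟩
      by_cases hi : i < 0
      · rw [hneg i hi, Submodule.mem_bot] at hu; simp [hu]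
      by_cases hj : j < 0
      · rw [hneg j hj, Submodule.mem_bot] at hv; simp [hv]
      refine ih.apply_neg_two_eq_zero hq hu hv (by push_cast at hk; omega)
        (by push_cast at hk; omega) (by push_cast at hk; omega) ?_
      have e : n - i - j = n - k + 1 := by omega
      rw [e]
      exact lt_of_le_of_lt (mul_le_mul_of_nonneg_left (by omega) hq) hn
    · simp
    · intro x y _ _ hx hy; simp [hx, hy]
    · intro a x _ hx; simp [hx]

/-- The modes of extremal slope of elements of large weight vanish. -/
theorem HasSlopeLE.extremal_eq_zero (hneg : ∀ n : ℤ, n < 0 → A.gr n = ⊥) {K : ℕ}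
    (hK : ∀ k : ℤ, K < k → A.gr k ≤ Submodule.span ℂ
      {y | ∃ i j : ℤ, ∃ u ∈ A.gr i, ∃ v ∈ A.gr j, i + j + 1 = k ∧ y = A.Y u (-2) v})
    (hq : 0 < q) (h : ∀ N, W.HasSlopeLE D q N w) {k : ℤ} (hk : K < k) {v : V}
    (hv : v ∈ A.gr k) {n : ℤ} (hn : (n - k + 1) * D = q * k) : W.Y v n w = 0 := by
  refine Submodule.span_induction (p := fun x _ => W.Y x n w = 0) ?_ ?_ ?_ ?_ (hK k hk hv)
  · rintro _ ⟨i, j, u, hu, v, hv, hij, rfl⟩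
    by_cases hi : i < 0
    · rw [hneg i hi, Submodule.mem_bot] at hu; simp [hu]
    by_cases hj : j < 0
    · rw [hneg j hj, Submodule.mem_bot] at hv; simp [hv]
    refine (h (i + j + 1)).apply_neg_two_eq_zero hq.le hu hv (by omega) (by omega) (by omega) ?_
    have e : n - i - j = n - k + 1 := by omega
    rw [e, hn]
    exact mul_lt_mul_of_pos_left (by omega) hq
  · simp
  · intro x y _ _ hx hy; simp [hx, hy]
  · intro a x _ hx; simp [hx]

theorem eq_zero_of_mem_gr_zero (h0 : A.gr 0 = Submodule.span ℂ {A.vac}) {v : V}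
    (hv : v ∈ A.gr 0) {n : ℤ} (hn : 0 ≤ n) (w : M) : W.Y v n w = 0 := by
  rw [h0] at hv
  obtain ⟨a, rfl⟩ := Submodule.mem_span_singleton.1 hv
  have : n ≠ -1 := by omega
  simp [W.vacuum, this]

/-! ### Existence and descent of slope bounds -/

theorem exists_hasSlopeLE (hCFT : A.IsCFTType) (hD : 0 < D) (K : ℕ) (w : M) :
    ∃ q : ℕ, W.HasSlopeLE D q (K + 1) w := by
  have hk : ∀ k : ℤ, ∃ B : ℤ, ∀ v ∈ A.gr k, ∀ n : ℤ, B ≤ n → W.Y v n w = 0 := by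
    intro k
    obtain ⟨s, hs⟩ := (Submodule.fg_iff_finiteDimensional _).2 (A.finite_gr k)
    choose f hf using fun v => W.truncation v w
    obtain ⟨B, hB⟩ := (s.image f).exists_le
    refine ⟨B, fun v hv n hn => ?_⟩
    rw [← hs] at hv
    refine Submodule.span_induction (p := fun x _ => W.Y x n w = 0) ?_ ?_ ?_ ?_ hv
    · intro x hx
      exact hf x n ((hB _ (Finset.mem_image_of_mem f hx)).trans hn)
    · simp
    · intro x y _ _ hx hy; simp [hx, hy]
    · intro a x _ hx; simp [hx]
  choose B hB using hk
  obtain ⟨C, hC⟩ := ((Finset.Icc (0 : ℤ) K).image B).exists_le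
  -- For `k ≥ 1` this `q` forces `n - k + 1 > C`; weight `0` needs only the vacuum.
  refine ⟨(C * D).toNat, fun k hkK v hv n hn => ?_⟩
  have hpos : 0 ≤ ((C * D).toNat : ℤ) := by positivity
  rcases lt_trichotomy k 0 with hk | rfl | hk
  · rw [hCFT.1 k hk, Submodule.mem_bot] at hv; simp [hv]
  · have : 0 < (n - 0 + 1) * D := by simpa using hn
    have := pos_of_mul_pos_left this hD.le
    exact eq_zero_of_mem_gr_zero hCFT.2 hv (by omega) w
  · refine hB k v hv n ((hC _ (Finset.mem_image_of_mem B
      (Finset.mem_Icc.2 ⟨hk.le, by omega⟩))).trans ?_)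
    have h1 : C * D ≤ ((C * D).toNat : ℤ) * k :=
      (Int.self_le_toNat _).trans (le_mul_of_one_le_right hpos (by omega))
    have := lt_of_mul_lt_mul_of_nonneg_right (h1.trans_lt hn) hD.le
    omega

theorem exists_hasSlopeLE_pred (hCFT : A.IsCFTType) {K : ℕ}
    (hK : ∀ k : ℤ, K < k → A.gr k ≤ Submodule.span ℂ
      {y | ∃ i j : ℤ, ∃ u ∈ A.gr i, ∃ v ∈ A.gr j, i + j + 1 = k ∧ y = A.Y u (-2) v})
    (hD : 0 < D) (hdvd : ∀ k : ℤ, 0 < k → k ≤ K → k ∣ D) (hq : 0 < q) (hw : w ≠ 0)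
    (h : ∀ N, W.HasSlopeLE D q N w) :
    ∃ w' ≠ 0, ∀ N, W.HasSlopeLE D (q - 1) N w' := by
  let P : ℤ → Prop := fun s => ∃ v ∈ A.gr s, ∃ n : ℤ, (n - s + 1) * D = q * s ∧ W.Y v n w ≠ 0
  have hP0 : P 0 := by
    refine ⟨A.vac, ?_, -1, by simp, ?_⟩
    · rw [hCFT.2]; exact Submodule.mem_span_singleton_self _
    · simpa [W.vacuum] using hw
  obtain ⟨s, ⟨v, hv, n, hn, hne⟩, hmax⟩ := Int.exists_greatest_of_bdd (P := P)
    ⟨K, fun s ⟨v, hv, n, hn, hne⟩ => not_lt.1 fun hs =>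
      hne (HasSlopeLE.extremal_eq_zero hCFT.1 hK hq h hs hv hn)⟩ ⟨0, hP0⟩
  refine ⟨W.Y v n w, hne, HasSlopeLE.of_generators hCFT.1 hK (by omega) ?_⟩
  intro k hk u hu m hm
  rcases lt_trichotomy k 0 with hk0 | rfl | hk0
  · rw [hCFT.1 k hk0, Submodule.mem_bot] at hu; simp [hu]
  · have : 0 < (m - 0 + 1) * D := by simpa using hm
    have := pos_of_mul_pos_left this hD.le
    exact eq_zero_of_mem_gr_zero hCFT.2 hu (by omega) _
  -- Since `k ∣ D`, the slope of `u_m` is an integer multiple of `1 / D`: above `(q - 1) / D` it is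
  -- at least `q / D`.
  obtain ⟨L, rfl⟩ := hdvd k hk0 (by omega)
  have h1 : q - 1 < (m - k + 1) * L := by
    refine lt_of_mul_lt_mul_of_nonneg_right (a := k) ?_ hk0.le
    linarith
  have h2 : q * k ≤ (m - k + 1) * (k * L) := by
    have := mul_le_mul_of_nonneg_right (show q ≤ (m - k + 1) * L by omega) hk0.le
    linarith
  rcases h2.lt_or_eq with h2 | h2
  · exact HasSlopeLE.apply h hq hv hn (k + 1) k (by omega) u hu m h2
  -- In the extremal case, `u_m v_n w ≠ 0` would be an extremal mode of `u_{-1} v ∈ V_{k+s}`,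
  -- against the maximality of `s`.
  · by_contra hcon
    rw [← (h (max (max (k + 1) (s + 1)) (k + s))).apply_neg_one hq hD hu hv (by omega) (by omega)
      (by omega) hk0 h2.symm hn] at hcon
    have hmem := A.mode_mem_gr hu hv (-1)
    have e : k + s - -1 - 1 = k + s := by ring
    rw [e] at hmem
    have := hmax (k + s) ⟨_, hmem, m + n + 1, by linarith, hcon⟩
    omega

end WeakModule

end VertexOperatorAlgebra

theorem lemma4p4 {V : Type*} [AddCommGroup V] [Module ℂ V]
    (A : VertexOperatorAlgebra V) (hCFT : A.IsCFTType) (hC2 : A.IsCofinite 2)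
    {M : Type*} [AddCommGroup M] [Module ℂ M] [Nontrivial M] (W : A.WeakModule M) :
    ∃ w : M, w ≠ 0 ∧ W.IsLowestWeightVector w := by
  obtain ⟨K, hK⟩ := A.exists_gr_le_span_of_isCofinite hC2
  have hD : (0 : ℤ) < (K.factorial : ℤ) := by exact_mod_cast K.factorial_pos
  have hdvd : ∀ k : ℤ, 0 < k → k ≤ K → k ∣ (K.factorial : ℤ) := by
    intro k hk hkK
    lift k to ℕ using hk.le
    exact_mod_cast Nat.dvd_factorial (by exact_mod_cast hk) (by exact_mod_cast hkK)
  have descent : ∀ q : ℕ, ∀ w : M, w ≠ 0 → (∀ N, W.HasSlopeLE K.factorial q N w) →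
      ∃ w' : M, w' ≠ 0 ∧ ∀ N, W.HasSlopeLE K.factorial 0 N w' := by
    intro q
    induction q with
    | zero => exact fun w hw h => ⟨w, hw, by simpa using h⟩
    | succ q ih =>
      intro w hw h
      obtain ⟨w', hw', h'⟩ := VertexOperatorAlgebra.WeakModule.exists_hasSlopeLE_pred hCFT hK hD
        hdvd (by positivity) hw h
      exact ih w' hw' (by simpa using h')
  obtain ⟨w, hw⟩ := exists_ne (0 : M)
  obtain ⟨q, hq⟩ := VertexOperatorAlgebra.WeakModule.exists_hasSlopeLE (W := W) hCFT hD K w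
  obtain ⟨w', hw', h'⟩ := descent q w hw
    (VertexOperatorAlgebra.WeakModule.HasSlopeLE.of_generators hCFT.1 hK (by positivity) hq)
  -- At `q = 0` the slope condition reads `0 < (n - k + 1) D`, that is, negative weight.
  refine ⟨w', hw', fun k v hv n hn => h' (k + 1) k (by omega) v hv n ?_⟩
  rw [zero_mul]
  exact mul_pos (by omega) hD
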